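/- For a set $P$ of points in the Euclidean plane $\mathbb{R}^2$, the visibility graph of $P$ is the simple undirected graph with vertex set $P$ in which two distinct points $p,q\in P$ are adjacent if and only if the open segment between $p$ and $q$ contains no point of $P$. A geometric realization of a graph $G$ is a point set $P\subset\mathbb{R}^2$ whose visibility graph is isomorphic to $G$, and $G$ is called a point visibility graph if it has a geometric realization. Theorem. There exists a finite point visibility graph $G$ such that every geometric realization of $G$ contains at least one point with at least one irrational coordinate. -/

import Mathlib

/-- The Euclidean plane `ℝ²`. -/
abbrev Plane : Type := EuclideanSpace ℝ (Fin 2)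

/-- The visibility graph of a set `P` of points in the plane: its vertices are the points of `P`,
and two distinct points are adjacent if and only if the open segment between them contains no
point of `P`. (For `p ≠ q` the open segment contains neither `p` nor `q`.) -/
def visibilityGraph (P : Set Plane) : SimpleGraph P where
  Adj p q := p ≠ q ∧ ∀ r ∈ P, r ∉ openSegment ℝ (p : Plane) (q : Plane)
  symm := ⟨fun p q h => ⟨h.1.symm, fun r hr => by
    rw [openSegment_symm]
    exact h.2 r hr⟩⟩
  loopless := ⟨fun _ h => h.1 rfl⟩

/-- The point set `P` is a geometric realization of the graph `G`: the graph `G` is isomorphic to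
the visibility graph of `P`. -/
def IsRealization {V : Type*} (G : SimpleGraph V) (P : Set Plane) : Prop :=
  Nonempty (G ≃g visibilityGraph P)

/-- `G` is a point visibility graph: it has a geometric realization. -/
def IsPointVisibilityGraph {V : Type*} (G : SimpleGraph V) : Prop :=
  ∃ P : Set Plane, IsRealization G P

/-! The graph comes from an apex with fourteen points on four rays, arranged so that blocked pairs
force a cross ratio of the rays to be the inverse golden ratio.

Describe a point on a ray from the apex by its height, the inverse of its distance. Projectively,
this sends the apex to infinity: collinearity of points on three rays becomes a linear relation
between heights, with coefficients the cross products of the directions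
(`IsRayChart.mem_openSegment_iff`).

The graph determines the configuration in every realization. The apex has four neighbours and every
other point lies behind one of them (`exists_adj_smul_eq`), so four rays carry everything. The
blocked pairs of neighbours fix the order of the rays (`isInside_of_blocked`). Points on consecutive
rays always see each other, and a point sees at most one farther point on its own ray; this puts
each vertex on its intended ray (`ray_eq`) and orders the heights needed.

Blockers are not known in advance, but four blocked pairs whose blockers have strictly decreasing
heights must use all four points of the middle ray in order (`eq_of_chain_of_mem`). After this is
done on both middle rays, one further blocked pair has just two possible blockers; one is
impossible, and the other gives ρ² + ρ = 1 for a cross ratio ρ of the four directions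
(`golden_of_incidences`). Rational coordinates would make ρ rational, contradicting the
irrationality of √5. -/

/-- The visibility graph of an indexed family of points. -/
def familyVisibilityGraph {V : Type*} (g : V → Plane) : SimpleGraph V where
  Adj u v := u ≠ v ∧ ∀ w, g w ∉ openSegment ℝ (g u) (g v)
  symm := ⟨fun u v h => ⟨h.1.symm, fun w => by
    rw [openSegment_symm]
    exact h.2 w⟩⟩
  loopless := ⟨fun _ h => h.1 rfl⟩

theorem isRealization_range {V : Type*} {g : V → Plane} (hg : Function.Injective g) :
    IsRealization (familyVisibilityGraph g) (Set.range g) := by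
  refine ⟨⟨Equiv.ofInjective g hg, ?_⟩⟩
  intro u v
  simp [visibilityGraph, familyVisibilityGraph, hg.eq_iff, Subtype.ext_iff]

/-- Labelling the points by the vertices of `G` turns the isomorphism into an equality of graphs, so
that later arguments can name individual vertices. -/
theorem IsRealization.exists_family {V : Type*} {G : SimpleGraph V} {P : Set Plane}
    (h : IsRealization G P) :
    ∃ g : V → Plane, Function.Injective g ∧ (∀ v, g v ∈ P) ∧ familyVisibilityGraph g = G := by
  obtain ⟨φ⟩ := h
  refine ⟨fun v => φ v, fun u v huv => φ.injective (Subtype.ext huv), fun v => (φ v).2, ?_⟩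
  ext u v
  rw [← φ.map_adj_iff]
  refine and_congr (φ.injective.ne_iff).symm ⟨fun H r hr => ?_, fun H w => H _ (φ w).2⟩
  have := H (φ.symm ⟨r, hr⟩)
  simpa using this

/-! ### Cross products in the plane -/

/-- The cross product of two plane vectors. -/
def planeCross (u v : Plane) : ℝ := u 0 * v 1 - u 1 * v 0

theorem planeCross_self (u : Plane) : planeCross u u = 0 := by
  unfold planeCross; ring

theorem planeCross_comm (u v : Plane) : planeCross u v = -planeCross v u := by
  unfold planeCross; ring

theorem planeCross_smul_left (t : ℝ) (u v : Plane) : planeCross (t • u) v = t * planeCross u v := by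
  simp [planeCross]; ring

theorem planeCross_smul_right (t : ℝ) (u v : Plane) : planeCross u (t • v) = t * planeCross u v := by
  simp [planeCross]; ring

theorem planeCross_add_left (u v w : Plane) : planeCross (u + v) w = planeCross u w + planeCross v w := by
  simp [planeCross]; ring

theorem planeCross_add_right (u v w : Plane) : planeCross u (v + w) = planeCross u v + planeCross u w := by
  simp [planeCross]; ring

/-- Cramer's rule: the linear dependence of three plane vectors, with explicit coefficients. -/
theorem planeCross_smul_add_planeCross_smul (u v w : Plane) :
    planeCross v w • u + planeCross u v • w = planeCross u w • v := by
  ext i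
  fin_cases i <;> simp [planeCross] <;> ring

/-! ### Ray coordinates and visibility -/

/-- The points `g v` other than the apex `g o` lie on rays from `g o` with directions `e i`: the
point `g v` is on the ray numbered `r v`, and `h v` is the inverse of its distance to the apex,
measured in units of `e (r v)`. -/
structure IsRayChart {V : Type*} (g : V → Plane) (o : V) (e : Fin 4 → Plane) (r : V → Fin 4)
    (h : V → ℝ) : Prop where
  pos : ∀ v, v ≠ o → 0 < h v
  eq : ∀ v, v ≠ o → g v = g o + (h v)⁻¹ • e (r v)

namespace IsRayChart

variable {V : Type*} {g : V → Plane} {o : V} {e : Fin 4 → Plane} {r : V → Fin 4} {h : V → ℝ}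

/-- The sign `κ` allows for both orientations of the plane. -/
theorem mem_openSegment_iff (S : IsRayChart g o e r h) {κ : ℝ} {u v w : V} (hu : u ≠ o)
    (hv : v ≠ o) (hw : w ≠ o) (huw : 0 < κ * planeCross (e (r u)) (e (r w))) :
    g v ∈ openSegment ℝ (g u) (g w) ↔
      0 < κ * planeCross (e (r u)) (e (r v)) ∧ 0 < κ * planeCross (e (r v)) (e (r w)) ∧
        planeCross (e (r u)) (e (r w)) * h v =
          planeCross (e (r v)) (e (r w)) * h u + planeCross (e (r u)) (e (r v)) * h w := by
  have pu := S.pos u hu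
  have pv := S.pos v hv
  have pw := S.pos w hw
  rw [S.eq u hu, S.eq v hv, S.eq w hw]
  generalize e (r u) = a at *
  generalize e (r v) = b at *
  generalize e (r w) = c at *
  constructor
  · rintro ⟨s, t, hs, ht, hst, H⟩
    -- Rescaling the convex combination by `h v` makes `b` a positive combination of `a` and `c`;
    -- crossing with `a` and with `c` reads off the coefficients.
    have key : b = (h v * s * (h u)⁻¹) • a + (h v * t * (h w)⁻¹) • c := by
      ext i
      have := congrArg (fun z : Plane => z i) H
      simp only [PiLp.add_apply, PiLp.smul_apply, smul_eq_mul] at this ⊢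
      field_simp at this ⊢
      linear_combination -this + h u * h w * h v * g o i * hst
    have h1 : planeCross a b = (h v * t * (h w)⁻¹) * planeCross a c := by
      rw [key, planeCross_add_right, planeCross_smul_right, planeCross_smul_right, planeCross_self]; ring
    have h2 : planeCross b c = (h v * s * (h u)⁻¹) * planeCross a c := by
      rw [key, planeCross_add_left, planeCross_smul_left, planeCross_smul_left, planeCross_self]; ring
    refine ⟨?_, ?_, ?_⟩
    · rw [h1, mul_left_comm]; positivity
    · rw [h2, mul_left_comm]; positivity
    · rw [h1, h2]; field_simp; linear_combination -planeCross a c * hst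
  · rintro ⟨h1, h2, h3⟩
    have hac : planeCross a c ≠ 0 := fun h0 => by simp [h0] at huw
    have hκ : κ ≠ 0 := fun h0 => by simp [h0] at huw
    have q1 : 0 < planeCross a b / planeCross a c := by
      rw [← mul_div_mul_left _ _ hκ]; positivity
    have q2 : 0 < planeCross b c / planeCross a c := by
      rw [← mul_div_mul_left _ _ hκ]; positivity
    have hsum : planeCross b c / planeCross a c * (h u / h v) +
        planeCross a b / planeCross a c * (h w / h v) = 1 := by
      field_simp
      linear_combination -h3
    -- The weights are the Cramer coefficients of `b` rescaled by heights; the linear relation `h3`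
    -- says exactly that they sum to 1.
    refine ⟨planeCross b c / planeCross a c * (h u / h v),
      planeCross a b / planeCross a c * (h w / h v), by positivity, by positivity, hsum, ?_⟩
    · have hb : b = (planeCross b c / planeCross a c) • a + (planeCross a b / planeCross a c) • c := by
        rw [div_eq_inv_mul, div_eq_inv_mul, mul_smul, mul_smul, ← smul_add,
          planeCross_smul_add_planeCross_smul, smul_smul, inv_mul_cancel₀ hac, one_smul]
      ext i
      have hbi := congrArg (fun z : Plane => z i) hb
      simp only [PiLp.add_apply, PiLp.smul_apply, smul_eq_mul] at hbi ⊢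
      generalize planeCross b c / planeCross a c = x at *
      generalize planeCross a b / planeCross a c = y at *
      rw [hbi]
      field_simp
      field_simp at hsum
      linear_combination (g o i) * hsum

theorem apex_notMem_openSegment (S : IsRayChart g o e r h) {u w : V} (hu : u ≠ o) (hw : w ≠ o)
    (huw : planeCross (e (r u)) (e (r w)) ≠ 0) : g o ∉ openSegment ℝ (g u) (g w) := by
  have pu := S.pos u hu
  have pw := S.pos w hw
  rw [S.eq u hu, S.eq w hw]
  rintro ⟨s, t, hs, ht, hst, H⟩
  apply huw
  generalize e (r u) = a at *
  generalize e (r w) = c at *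
  have key : (s * (h u)⁻¹) • a + (t * (h w)⁻¹) • c = 0 := by
    ext i
    have := congrArg (fun z : Plane => z i) H
    simp at this ⊢
    linear_combination this - g o i * hst
  have := congrArg (planeCross a) key
  rw [planeCross_add_right, planeCross_smul_right, planeCross_smul_right, planeCross_self] at this
  have h0 : planeCross a 0 = 0 := by simp [planeCross]
  rw [h0, mul_zero, zero_add] at this
  exact (mul_eq_zero.1 this).resolve_left (by positivity)

/-- On one ray, visibility is blocked by every point in between. -/
theorem not_adj_of_same_ray (S : IsRayChart g o e r h) {u v w : V} (hu : u ≠ o) (hv : v ≠ o)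
    (hw : w ≠ o) (huv : r u = r v) (hvw : r v = r w) (h1 : h v < h u) (h2 : h w < h v) :
    ¬ (familyVisibilityGraph g).Adj u w := by
  intro H
  apply H.2 v
  have pu := S.pos u hu
  have pv := S.pos v hv
  have pw := S.pos w hw
  rw [S.eq u hu, S.eq v hv, S.eq w hw, huv, hvw]
  generalize e (r w) = a at *
  have d : 0 < h u - h w := by linarith
  -- The weights solve s + t = 1 and s / h u + t / h w = 1 / h v.
  refine ⟨h u * (h v - h w) / (h v * (h u - h w)), h w * (h u - h v) / (h v * (h u - h w)), ?_, ?_,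
    ?_, ?_⟩
  · have : 0 < h v - h w := by linarith
    positivity
  · have : 0 < h u - h v := by linarith
    positivity
  · field_simp; ring
  · ext i
    simp
    field_simp
    ring

theorem apex_not_adj (S : IsRayChart g o e r h) {u v : V} (hu : u ≠ o) (hv : v ≠ o)
    (huv : r u = r v) (h1 : h v < h u) : ¬ (familyVisibilityGraph g).Adj o v := by
  intro H
  apply H.2 u
  have pu := S.pos u hu
  have pv := S.pos v hv
  rw [S.eq u hu, S.eq v hv, huv]
  generalize e (r v) = a at *
  refine ⟨(h u - h v) / h u, h v / h u, ?_, by positivity, ?_, ?_⟩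
  · have : 0 < h u - h v := by linarith
    positivity
  · field_simp; ring
  · ext i
    simp
    field_simp
    ring

/-- If `κ * planeCross (e (r u)) (e (r w))` is positive then every blocker of `u` and `w` lies on a ray
strictly inside the angle spanned by the rays of `u` and `w`. -/
theorem exists_blocker (S : IsRayChart g o e r h) {κ : ℝ} {u w : V} (hu : u ≠ o) (hw : w ≠ o)
    (huw : 0 < κ * planeCross (e (r u)) (e (r w))) (H : ¬ (familyVisibilityGraph g).Adj u w) :
    ∃ v, v ≠ o ∧ 0 < κ * planeCross (e (r u)) (e (r v)) ∧ 0 < κ * planeCross (e (r v)) (e (r w)) ∧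
        planeCross (e (r u)) (e (r w)) * h v =
          planeCross (e (r v)) (e (r w)) * h u + planeCross (e (r u)) (e (r v)) * h w := by
  have hne : u ≠ w := by rintro rfl; simp [planeCross_self] at huw
  have hac : planeCross (e (r u)) (e (r w)) ≠ 0 := fun h0 => by simp [h0] at huw
  have : ∃ v, g v ∈ openSegment ℝ (g u) (g w) := by
    by_contra! h'
    exact H ⟨hne, h'⟩
  obtain ⟨v, hv⟩ := this
  have hvo : v ≠ o := by
    rintro rfl
    exact S.apex_notMem_openSegment hu hw hac hv
  exact ⟨v, hvo, (S.mem_openSegment_iff hu hvo hw huw).1 hv⟩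

theorem not_adj_of_blocker (S : IsRayChart g o e r h) {κ : ℝ} {u v w : V} (hu : u ≠ o)
    (hv : v ≠ o) (hw : w ≠ o) (huw : 0 < κ * planeCross (e (r u)) (e (r w)))
    (h1 : 0 < κ * planeCross (e (r u)) (e (r v))) (h2 : 0 < κ * planeCross (e (r v)) (e (r w)))
    (h3 : planeCross (e (r u)) (e (r w)) * h v =
      planeCross (e (r v)) (e (r w)) * h u + planeCross (e (r u)) (e (r v)) * h w) :
    ¬ (familyVisibilityGraph g).Adj u w := fun H =>
  H.2 v ((S.mem_openSegment_iff hu hv hw huw).2 ⟨h1, h2, h3⟩)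

end IsRayChart

namespace IsRayChart

variable {V : Type*} {g : V → Plane} {o : V} {e : Fin 4 → Plane} {r : V → Fin 4} {h : V → ℝ}

theorem ray_eq_of_smul_eq (he : ∀ i j, i ≠ j → planeCross (e i) (e j) ≠ 0) {i j : Fin 4} {s t : ℝ}
    (ht : t ≠ 0) (H : s • e i = t • e j) : i = j := by
  by_contra hij
  have := congrArg (planeCross (e i)) H
  rw [planeCross_smul_right, planeCross_smul_right, planeCross_self, mul_zero] at this
  exact (mul_ne_zero ht (he i j hij)) this.symm

theorem direction_ne_zero (he : ∀ i j, i ≠ j → planeCross (e i) (e j) ≠ 0) (i : Fin 4) :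
    e i ≠ 0 := by
  intro h0
  have hi : i ≠ i + 1 := by clear h0; revert i; decide
  apply he i (i + 1) hi
  simp [h0, planeCross]

/-- A blocker would be a positive multiple of the common direction away from the apex. As distinct
rays are not parallel, it lies on the same ray, with height strictly between the two. -/
theorem adj_of_same_ray (S : IsRayChart g o e r h)
    (he : ∀ i j, i ≠ j → planeCross (e i) (e j) ≠ 0) {u w : V} (hu : u ≠ o)
    (hw : w ≠ o) (huw : r u = r w) (hlt : h w < h u)
    (H : ∀ v, v ≠ o → r v = r w → h w < h v → h u ≤ h v) :
    (familyVisibilityGraph g).Adj u w := by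
  refine ⟨by rintro rfl; exact lt_irrefl _ hlt, fun v hv => ?_⟩
  have pu := S.pos u hu
  have pw := S.pos w hw
  rw [S.eq u hu, S.eq w hw, huw] at hv
  obtain ⟨s, t, hs, ht, hst, hv⟩ := hv
  have key : g v = g o + (s * (h u)⁻¹ + t * (h w)⁻¹) • e (r w) := by
    rw [← hv]
    ext i
    simp only [PiLp.add_apply, PiLp.smul_apply, smul_eq_mul]
    linear_combination (g o i) * hst
  have hτ : 0 < s * (h u)⁻¹ + t * (h w)⁻¹ := by positivity
  have hvo : v ≠ o := by
    rintro rfl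
    have h0 : (s * (h u)⁻¹ + t * (h w)⁻¹) • e (r w) = 0 := left_eq_add.1 key
    exact direction_ne_zero he _ ((smul_eq_zero.1 h0).resolve_left hτ.ne')
  have pv := S.pos v hvo
  rw [S.eq v hvo, add_right_inj] at key
  have hr := ray_eq_of_smul_eq he hτ.ne' key
  rw [hr] at key
  have hinv := smul_left_injective ℝ (direction_ne_zero he (r w)) key
  have hlt' : (h u)⁻¹ < (h w)⁻¹ := (inv_lt_inv₀ pu pw).2 hlt
  have h1 : h w < h v := by
    rw [← inv_lt_inv₀ pv pw, hinv]
    nlinarith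
  have h2 : h v < h u := by
    rw [← inv_lt_inv₀ pu pv, hinv]
    nlinarith
  exact absurd (H v hvo hr h1) (not_le.2 h2)

theorem apex_adj (S : IsRayChart g o e r h)
    (he : ∀ i j, i ≠ j → planeCross (e i) (e j) ≠ 0) {w : V} (hw : w ≠ o)
    (H : ∀ v, v ≠ o → r v = r w → h v ≤ h w) :
    (familyVisibilityGraph g).Adj o w := by
  refine ⟨hw.symm, fun v hv => ?_⟩
  have pw := S.pos w hw
  rw [S.eq w hw] at hv
  obtain ⟨s, t, hs, ht, hst, hv⟩ := hv
  have key : g v = g o + (t * (h w)⁻¹) • e (r w) := by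
    rw [← hv]
    ext i
    simp only [PiLp.add_apply, PiLp.smul_apply, smul_eq_mul]
    linear_combination (g o i) * hst
  have hτ : 0 < t * (h w)⁻¹ := by positivity
  have hvo : v ≠ o := by
    rintro rfl
    have h0 : (t * (h w)⁻¹) • e (r w) = 0 := left_eq_add.1 key
    exact direction_ne_zero he _ ((smul_eq_zero.1 h0).resolve_left hτ.ne')
  have pv := S.pos v hvo
  rw [S.eq v hvo, add_right_inj] at key
  have hr := ray_eq_of_smul_eq he hτ.ne' key
  rw [hr] at key
  have hinv := smul_left_injective ℝ (direction_ne_zero he (r w)) key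
  have h2 : h w < h v := by
    rw [← inv_lt_inv₀ pv pw, hinv]
    have := inv_pos.2 pw
    nlinarith
  exact absurd (H v hvo hr) (not_le.2 h2)

end IsRayChart

/-! ### The explicit configuration and its visibility graph -/

/-- The vertices of the graph: an apex `o` and the points on four rays from it. -/
inductive Vertex
  | o
  | a0 | a1 | a2
  | b0 | b1 | b2 | b3
  | c0 | c1 | c2 | c3
  | d0 | d1 | d2
  deriving DecidableEq

namespace Vertex

instance : Finite Vertex := by
  refine Finite.of_surjective
    ![o, a0, a1, a2, b0, b1, b2, b3, c0, c1, c2, c3, d0, d1, d2] fun v => ?_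
  cases v
  exacts [⟨0, rfl⟩, ⟨1, rfl⟩, ⟨2, rfl⟩, ⟨3, rfl⟩, ⟨4, rfl⟩, ⟨5, rfl⟩, ⟨6, rfl⟩, ⟨7, rfl⟩, ⟨8, rfl⟩,
    ⟨9, rfl⟩, ⟨10, rfl⟩, ⟨11, rfl⟩, ⟨12, rfl⟩, ⟨13, rfl⟩, ⟨14, rfl⟩]

/-- The ray on which a vertex lies (with a dummy value at the apex). -/
def ray : Vertex → Fin 4
  | o => 0
  | a0 => 0 | a1 => 0 | a2 => 0
  | b0 => 1 | b1 => 1 | b2 => 1 | b3 => 1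
  | c0 => 2 | c1 => 2 | c2 => 2 | c3 => 2
  | d0 => 3 | d1 => 3 | d2 => 3

/-- The inverse of the golden ratio. -/
noncomputable def invGold : ℝ := (√5 - 1) / 2

theorem invGold_sq : invGold ^ 2 = 1 - invGold := by
  have : √5 ^ 2 = 5 := Real.sq_sqrt (by norm_num)
  unfold invGold
  linear_combination this / 4

theorem lt_invGold : 0.618 < invGold := by
  have : (2.236 : ℝ) < √5 := by
    rw [Real.lt_sqrt (by norm_num)]; norm_num
  unfold invGold
  linarith

theorem invGold_lt : invGold < 0.6181 := by
  have : √5 < (2.2362 : ℝ) := by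
    rw [Real.sqrt_lt' (by norm_num)]; norm_num
  unfold invGold
  linarith

/-- The inverse distance from the apex. -/
noncomputable def height : Vertex → ℝ
  -- The dummy value is the maximal height, so the apex, whose dummy ray is 0, never violates the
  -- betweenness condition in `graph_adj_of_same_ray`.
  | o => 3
  | a0 => 3 | a1 => 3 - 2 * invGold | a2 => 1
  | b0 => 3 | b1 => 4 - 2 * invGold | b2 => 2 + invGold | b3 => 2
  | c0 => 3 | c1 => -1 + 6 * invGold | c2 => 5 - 4 * invGold | c3 => 1 + 2 * invGold
  | d0 => 3 | d1 => 3 - 2 * invGold | d2 => 1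

/-- The slopes of the four rays. -/
noncomputable def slope : Fin 4 → ℝ :=
  -- With slopes s₀, s₁, s₂, s₃, the cross ratio (s₁ - s₀)(s₃ - s₂) / ((s₂ - s₀)(s₃ - s₁)) equals
  -- `invGold`.
  ![0, 2 * invGold + 3, 2 * invGold + 4, 4 * invGold + 6]

/-- The directions of the four rays. -/
noncomputable def direction (i : Fin 4) : Plane := !₂[1, slope i]

/-- The position of a vertex in the plane. -/
noncomputable def point : Vertex → Plane
  | o => 0
  | v => (height v)⁻¹ • direction (ray v)

theorem planeCross_direction (i j : Fin 4) :
    planeCross (direction i) (direction j) = slope j - slope i := by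
  simp [planeCross, direction]

theorem slope_strictMono : StrictMono slope := by
  have := lt_invGold
  rw [Fin.strictMono_iff_lt_succ]
  intro i
  fin_cases i <;> simp [slope] <;> linarith

theorem planeCross_direction_pos {i j : Fin 4} (hij : i < j) :
    0 < 1 * planeCross (direction i) (direction j) := by
  rw [planeCross_direction, one_mul, sub_pos]
  exact slope_strictMono hij

theorem planeCross_direction_ne_zero (i j : Fin 4) (hij : i ≠ j) :
    planeCross (direction i) (direction j) ≠ 0 := by
  rw [planeCross_direction, sub_ne_zero]
  exact slope_strictMono.injective.ne hij.symm

theorem isRayChart_point : IsRayChart point o direction ray height where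
  pos v _ := by
    have := lt_invGold
    have := invGold_lt
    cases v <;> simp only [height] <;> linarith
  eq v hv := by
    cases v <;> first | exact absurd rfl hv | simp [point]

theorem eq_of_ray_eq_of_height_eq {u v : Vertex} (hu : u ≠ o) (hv : v ≠ o) (hr : ray u = ray v)
    (hh : height u = height v) : u = v := by
  have := lt_invGold
  have := invGold_lt
  cases u <;> cases v <;> first
    | rfl
    | exact absurd rfl hu
    | exact absurd rfl hv
    | exact absurd hr (by decide)
    | (simp only [height] at hh; linarith)

theorem point_injective : Function.Injective point := by
  have S := isRayChart_point
  have he := planeCross_direction_ne_zero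
  have ho : ∀ v, v ≠ o → point v ≠ point o := by
    intro v hv h0
    rw [S.eq v hv, add_eq_left] at h0
    exact IsRayChart.direction_ne_zero he _
      ((smul_eq_zero.1 h0).resolve_left (inv_pos.2 (S.pos v hv)).ne')
  intro u v huv
  by_cases hu : u = o
  · subst hu
    by_contra hv
    exact ho v (Ne.symm hv) huv.symm
  by_cases hv : v = o
  · subst hv
    exact absurd huv (ho u hu)
  rw [S.eq u hu, S.eq v hv, add_right_inj] at huv
  have hr := IsRayChart.ray_eq_of_smul_eq he (inv_pos.2 (S.pos v hv)).ne' huv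
  rw [hr] at huv
  exact eq_of_ray_eq_of_height_eq hu hv hr
    (inv_injective (smul_left_injective ℝ (IsRayChart.direction_ne_zero he _) huv))

/-- The visibility graph of the fifteen points. -/
noncomputable def graph : SimpleGraph Vertex := familyVisibilityGraph point

theorem graph_not_adj {u w : Vertex} (v : Vertex) (hu : u ≠ o) (h1 : ray u < ray v)
    (h2 : ray v < ray w)
    (h3 : (slope (ray w) - slope (ray u)) * height v =
      (slope (ray w) - slope (ray v)) * height u + (slope (ray v) - slope (ray u)) * height w) :
    ¬ graph.Adj u w := by
  -- The dummy ray of the apex is the least one, so the strict ray inequalities already exclude `o`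
  -- for `v` and `w`.
  have ho : ∀ x : Vertex, x = o → ray x = 0 := by rintro x rfl; rfl
  have hv : v ≠ o := fun h => by simp [ho v h] at h1
  have hw : w ≠ o := fun h => by simp [ho w h] at h2
  refine isRayChart_point.not_adj_of_blocker hu hv hw
    (planeCross_direction_pos (h1.trans h2)) (planeCross_direction_pos h1)
    (planeCross_direction_pos h2) ?_
  simpa only [planeCross_direction] using h3

theorem graph_adj {u w : Vertex} (hu : u ≠ o) (h1 : ray u < ray w)
    (h : ∀ v, ray u < ray v → ray v < ray w →
      (slope (ray w) - slope (ray u)) * height v ≠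
      (slope (ray w) - slope (ray v)) * height u + (slope (ray v) - slope (ray u)) * height w) :
    graph.Adj u w := by
  have hw : w ≠ o := by rintro rfl; simp [ray] at h1
  by_contra H
  obtain ⟨v, -, p1, p2, p3⟩ := isRayChart_point.exists_blocker hu hw
    (planeCross_direction_pos h1) H
  simp only [planeCross_direction, one_mul, sub_pos, slope_strictMono.lt_iff_lt] at p1 p2 p3
  exact h v p1 p2 p3

theorem graph_adj_of_same_ray {u w : Vertex} (hu : u ≠ o) (hw : w ≠ o) (huw : ray u = ray w)
    (hlt : height w < height u) (H : ∀ v, ray v = ray w → height w < height v → height u ≤ height v) :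
    graph.Adj u w :=
  isRayChart_point.adj_of_same_ray planeCross_direction_ne_zero hu hw huw hlt fun v _ => H v

/-- Pairs of vertices that see each other. -/
def visiblePairs : List (Vertex × Vertex) :=
  [(a0, a1), (a1, a2), (b0, b1), (b1, b2), (c0, c1), (c1, c2), (d0, d1), (d1, d2),
    (a0, b1), (a0, b2), (a0, b3), (c1, d0), (c2, d0), (c3, d0),
    (a0, c3), (a1, c1), (a1, c2), (b1, d0), (b2, d1), (b3, d1)]

/-- Triples of vertices, the second of which lies between the others. -/
def blockedTriples : List (Vertex × Vertex × Vertex) :=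
  [(a0, b0, c0), (b0, c0, d0), (a0, b0, d0),
    (a1, b1, c0), (a1, c2, d0), (a2, b2, c0), (a2, b3, d0),
    (a0, c3, d1), (b0, c1, d1), (a0, b3, d2), (b0, c2, d2),
    (b1, c2, d1), (b2, c1, d0), (b3, c3, d0), (a0, b1, c1), (a0, b2, c2), (a2, b3, c3),
    (b2, c3, d2)]

theorem graph_adj_of_mem_visiblePairs : ∀ p ∈ visiblePairs, graph.Adj p.1 p.2 := by
  have h1 := lt_invGold
  have h2 := invGold_lt
  have h3 := invGold_sq
  simp only [visiblePairs, List.forall_mem_cons]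
  refine ⟨?_, ?_, ?_, ?_, ?_, ?_, ?_, ?_, ?_, ?_, ?_, ?_, ?_, ?_, ?_, ?_, ?_, ?_, ?_, ?_, by simp⟩
  -- The first eight pairs share a ray; the other twelve lie on different rays. With `invGold ^ 2`
  -- reduced to `1 - invGold`, every condition is affine in `invGold` and is decided by the decimal
  -- bounds.
  iterate 8
    refine graph_adj_of_same_ray (by decide) (by decide) (by decide)
      (by simp only [height]; linarith) fun v hv => ?_
    cases v <;> first | exact absurd hv (by decide) | (simp only [height]; intros; linarith)
  iterate 12
    refine graph_adj (by decide) (by decide) fun v p q => ?_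
    cases v <;> first
      | exact absurd p (by decide)
      | exact absurd q (by decide)
      | (simp [height, slope, ray]; intro; linarith)

theorem graph_not_adj_of_mem_blockedTriples : ∀ p ∈ blockedTriples, ¬ graph.Adj p.1 p.2.2 := by
  have h3 := invGold_sq
  have key : ∀ p ∈ blockedTriples,
      (slope (ray p.2.2) - slope (ray p.1)) * height p.2.1 =
        (slope (ray p.2.2) - slope (ray p.2.1)) * height p.1 +
          (slope (ray p.2.1) - slope (ray p.1)) * height p.2.2 := by
    simp only [blockedTriples, List.forall_mem_cons]
    refine ⟨?_, ?_, ?_, ?_, ?_, ?_, ?_, ?_, ?_, ?_, ?_, ?_, ?_, ?_, ?_, ?_, ?_, ?_, by simp⟩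
    all_goals simp [height, slope, ray]; try linarith
  have order : ∀ p ∈ blockedTriples, p.1 ≠ o ∧ ray p.1 < ray p.2.1 ∧ ray p.2.1 < ray p.2.2 := by
    decide
  intro p hp
  obtain ⟨q1, q2, q3⟩ := order p hp
  exact graph_not_adj p.2.1 q1 q2 q3 (key p hp)

/-- The four vertices that the apex sees, one on each ray. -/
def first : Fin 4 → Vertex := ![a0, b0, c0, d0]

theorem graph_apex_adj_first (i : Fin 4) : graph.Adj o (first i) := by
  have := lt_invGold
  have := invGold_lt
  fin_cases i <;>
    refine isRayChart_point.apex_adj planeCross_direction_ne_zero (by decide) fun v _ hv => ?_ <;>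
    cases v <;> first | exact absurd hv (by decide) | (simp [height, first]; try linarith)

theorem exists_eq_first_of_graph_apex_adj {v : Vertex} (hv : graph.Adj o v) :
    ∃ i, v = first i := by
  by_contra! H
  have := lt_invGold
  have := invGold_lt
  revert hv
  cases v
  case o => exact graph.loopless.irrefl o
  case a0 => exact absurd rfl (H 0)
  case b0 => exact absurd rfl (H 1)
  case c0 => exact absurd rfl (H 2)
  case d0 => exact absurd rfl (H 3)
  case a1 | a2 =>
    exact isRayChart_point.apex_not_adj (u := a0) (by decide) (by decide) rfl
      (by simp only [height]; linarith)
  case b1 | b2 | b3 =>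
    exact isRayChart_point.apex_not_adj (u := b0) (by decide) (by decide) rfl
      (by simp only [height]; linarith)
  case c1 | c2 | c3 =>
    exact isRayChart_point.apex_not_adj (u := c0) (by decide) (by decide) rfl
      (by simp only [height]; linarith)
  case d1 | d2 =>
    exact isRayChart_point.apex_not_adj (u := d0) (by decide) (by decide) rfl
      (by simp only [height]; linarith)

end Vertex

/-! ### The order of four directions from blocked pairs -/

/-- The vectors `u` and `v` point in opposite directions. -/
def IsOpposite (u v : Plane) : Prop := ∃ t : ℝ, 0 < t ∧ u = (-t) • v

/-- The vector `v` points strictly inside the angle spanned by `u` and `w`. -/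
def IsInside (u v w : Plane) : Prop :=
  0 < planeCross u w * planeCross u v ∧ 0 < planeCross u w * planeCross v w

theorem IsOpposite.symm {u v : Plane} (h : IsOpposite u v) : IsOpposite v u := by
  obtain ⟨t, ht, rfl⟩ := h
  refine ⟨t⁻¹, inv_pos.2 ht, ?_⟩
  rw [smul_smul, neg_mul_neg, inv_mul_cancel₀ ht.ne', one_smul]

theorem IsInside.symm {u v w : Plane} (h : IsInside u v w) : IsInside w v u := by
  unfold IsInside at *
  rw [planeCross_comm w u, planeCross_comm w v, planeCross_comm v u]
  constructor <;> linarith [h.1, h.2]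

theorem IsOpposite.sameDirection {u v w : Plane} (h : IsOpposite u v) (h' : IsOpposite u w) :
    ∃ t : ℝ, 0 < t ∧ v = t • w := by
  obtain ⟨s, hs, rfl⟩ := h.symm
  obtain ⟨t, ht, rfl⟩ := h'
  exact ⟨s * t, mul_pos hs ht, by rw [smul_smul, neg_mul_neg]⟩

theorem IsOpposite.planeCross_eq_zero {u v : Plane} (h : IsOpposite u v) :
    planeCross u v = 0 := by
  obtain ⟨t, -, rfl⟩ := h
  rw [planeCross_smul_left, planeCross_self, mul_zero]

theorem pos_of_mul_pos_common {a b c : ℝ} (h1 : 0 < a * b) (h2 : 0 < a * c) : 0 < b * c := by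
  rcases pos_and_pos_or_neg_and_neg_of_mul_pos h1 with ⟨p, q⟩ | ⟨p, q⟩
  · exact mul_pos q (pos_of_mul_pos_right h2 p.le)
  · exact mul_pos_of_neg_of_neg q (by nlinarith)

/-- If `x` and `z` were opposite, `y` would lie off their line, and the blocking of `y` and `w`
would put `w` on the other side from `y`. Then nothing can block `x` and `w`: `y` is on the wrong
side, and `z` is parallel to `x`. -/
theorem not_isOpposite_of_blocked {x y z w : Plane}
    (hxy : planeCross x y = 0 → IsOpposite x y) (hyz : ∀ t : ℝ, 0 < t → y ≠ t • z)
    (hzw : ∀ t : ℝ, 0 < t → z ≠ t • w)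
    (hyw : IsOpposite y w ∨ IsInside y x w ∨ IsInside y z w)
    (hxw : IsOpposite x w ∨ IsInside x y w ∨ IsInside x z w) : ¬ IsOpposite x z := by
  intro hxz
  have hc : planeCross x y ≠ 0 := fun h0 => by
    obtain ⟨t, ht, h⟩ := (hxy h0).sameDirection hxz
    exact hyz t ht h
  have hneg : planeCross x y * planeCross x w < 0 := by
    rcases hyw with h | h | h
    · obtain ⟨s, hs, rfl⟩ := h
      rw [planeCross_smul_right] at hc ⊢
      have : planeCross x w ≠ 0 := fun h0 => by simp [h0] at hc
      have := mul_pos hs (mul_self_pos.2 this)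
      linarith
    · have := pos_of_mul_pos_common h.1 h.2
      rw [planeCross_comm y x] at this
      linarith
    · have := pos_of_mul_pos_common h.1 h.2
      obtain ⟨t, ht, rfl⟩ := hxz
      rw [planeCross_smul_left, planeCross_smul_left, planeCross_comm z y]
      have := mul_pos (mul_pos ht ht) this
      linarith
  rcases hxw with h | h | h
  · obtain ⟨t, ht, h⟩ := hxz.sameDirection h
    exact hzw t ht h
  · linarith [h.1]
  · have := h.1
    rw [hxz.planeCross_eq_zero] at this
    simp at this

/-- If `w` were inside the angle of `x` and `z`, only `y` could block `x` and `w`. The order would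
be `x`, `y`, `w`, `z`, where neither `x` nor `z` is between `y` and `w`. -/
theorem not_isInside_of_blocked {x y z w : Plane}
    (hyw : IsInside y x w ∨ IsInside y z w)
    (hxw : IsOpposite x w ∨ IsInside x y w ∨ IsInside x z w) : ¬ IsInside x w z := by
  intro hxz
  have h1 := pos_of_mul_pos_common hxz.1 hxz.2
  rw [planeCross_comm w z] at h1
  rcases hxw with h | h | h
  · have := hxz.1
    rw [h.planeCross_eq_zero] at this
    simp at this
  · rcases hyw with h' | h'
    · have p := pos_of_mul_pos_common h.1 h.2
      have q := h'.1
      rw [planeCross_comm y x] at q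
      linarith
    · have p := pos_of_mul_pos_common h'.1 h'.2
      have q := h'.2
      have s := pos_of_mul_pos_common h.2 (by linarith : 0 < planeCross x w * -planeCross z w)
      linarith
  · linarith [h.2]

/-- Four directions whose pairs, except for neighbours in the list, are all blocked are in the
order of the list. -/
theorem isInside_of_blocked {x y z w : Plane}
    (hxy : planeCross x y = 0 → IsOpposite x y) (hzw' : planeCross w z = 0 → IsOpposite w z)
    (hyx : ∀ t : ℝ, 0 < t → y ≠ t • x) (hyz : ∀ t : ℝ, 0 < t → y ≠ t • z)
    (hzy : ∀ t : ℝ, 0 < t → z ≠ t • y) (hzw : ∀ t : ℝ, 0 < t → z ≠ t • w)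
    (hxz : IsOpposite x z ∨ IsInside x y z ∨ IsInside x w z)
    (hyw : IsOpposite y w ∨ IsInside y x w ∨ IsInside y z w)
    (hxw : IsOpposite x w ∨ IsInside x y w ∨ IsInside x z w) :
    IsInside x y z ∧ IsInside y z w := by
  -- The hypotheses are symmetric under reversing the list `x`, `y`, `z`, `w`, so each exclusion
  -- lemma applies twice.
  have swap : ∀ {a b c d : Plane}, IsOpposite a d ∨ IsInside a b d ∨ IsInside a c d →
      IsOpposite d a ∨ IsInside d c a ∨ IsInside d b a := by
    rintro a b c d (h | h | h)
    exacts [Or.inl h.symm, Or.inr (Or.inr h.symm), Or.inr (Or.inl h.symm)]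
  have n1 := not_isOpposite_of_blocked hxy hyz hzw hyw hxw
  have n2 : ¬ IsOpposite w y := not_isOpposite_of_blocked hzw' hzy hyx
    (swap hxz) (swap hxw)
  have hyw' := hyw.resolve_left fun h => n2 h.symm
  have hxz' := hxz.resolve_left n1
  have m1 := not_isInside_of_blocked hyw' hxw
  have m2 : ¬ IsInside w x y := not_isInside_of_blocked
    ((swap hxz).resolve_left fun h => n1 h.symm) (swap hxw)
  exact ⟨hxz'.resolve_right m1, hyw'.resolve_left fun h => m2 h.symm⟩

/-! ### The rays through the neighbours of the apex -/

/-- Every point lies behind, or is, a point that the apex sees. -/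
theorem exists_adj_smul_eq {V : Type*} [Finite V] {g : V → Plane} (hg : Function.Injective g)
    {o v : V} (hv : v ≠ o) :
    ∃ q, (familyVisibilityGraph g).Adj o q ∧
      ∃ t : ℝ, 0 < t ∧ t ≤ 1 ∧ t • (g v - g o) = g q - g o := by
  -- Among the finitely many points between the apex and `g v`, including `g v`, the nearest to the
  -- apex is visible from it.
  let T : Set V := {w | w ≠ o ∧ ∃ t : ℝ, 0 < t ∧ t ≤ 1 ∧ t • (g v - g o) = g w - g o}
  have hT : T.Nonempty := ⟨v, hv, 1, one_pos, le_rfl, one_smul _ _⟩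
  obtain ⟨q, ⟨hqo, t, ht, ht1, hq⟩, hmin⟩ :=
    Set.exists_min_image T (fun w => ‖g w - g o‖) T.toFinite hT
  refine ⟨q, ⟨hqo.symm, fun z hz => ?_⟩, t, ht, ht1, hq⟩
  rw [openSegment_eq_image'] at hz
  obtain ⟨s, ⟨hs, hs1⟩, hz⟩ := hz
  have hz' : g z - g o = s • (g q - g o) := by rw [← hz]; simp
  have hq0 : g q - g o ≠ 0 := sub_ne_zero.2 (hg.ne hqo)
  have hzo : z ≠ o := by
    rintro rfl
    rw [sub_self] at hz'
    exact (smul_ne_zero hs.ne' hq0) hz'.symm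
  have := hmin z ⟨hzo, s * t, by positivity, by nlinarith, by rw [hz', ← hq, smul_smul]⟩
  simp only [hz', norm_smul, Real.norm_eq_abs, abs_of_pos hs] at this
  have := norm_pos_iff.2 hq0
  nlinarith

/-- Of two distinct points in the same direction, the nearer hides the farther from the apex. -/
theorem eq_of_apex_adj_of_smul_eq {V : Type*} {g : V → Plane} (hg : Function.Injective g)
    {o u w : V} (hu : (familyVisibilityGraph g).Adj o u) (hw : (familyVisibilityGraph g).Adj o w)
    {t : ℝ} (ht : 0 < t) (h : g u - g o = t • (g w - g o)) : u = w := by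
  rcases lt_trichotomy t 1 with h1 | h1 | h1
  · refine absurd ?_ (hw.2 u)
    rw [openSegment_eq_image']
    exact ⟨t, ⟨ht, h1⟩, by simp [← h]⟩
  · rw [h1, one_smul, sub_left_inj] at h
    exact hg h
  · refine absurd ?_ (hu.2 w)
    rw [openSegment_eq_image']
    refine ⟨t⁻¹, ⟨inv_pos.2 ht, inv_lt_one_of_one_lt₀ h1⟩, ?_⟩
    simp [h, smul_smul, inv_mul_cancel₀ ht.ne']

theorem exists_smul_eq_of_planeCross_eq_zero {u v : Plane} (hu : u ≠ 0) (hv : v ≠ 0)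
    (h : planeCross u v = 0) : ∃ t : ℝ, t ≠ 0 ∧ u = t • v := by
  unfold planeCross at h
  have key : ∃ t : ℝ, u = t • v := by
    by_cases h0 : v 0 = 0
    · have h1 : v 1 ≠ 0 := fun h1 => hv (by ext i; fin_cases i <;> simp [h0, h1])
      have hu0 : u 0 = 0 := by
        rw [h0, mul_zero, sub_zero] at h
        exact (mul_eq_zero.1 h).resolve_right h1
      refine ⟨u 1 / v 1, ?_⟩
      ext i
      fin_cases i
      · simp [h0, hu0]
      · simp [h1]
    · refine ⟨u 0 / v 0, ?_⟩
      ext i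
      fin_cases i
      · simp [h0]
      · simp; field_simp; linarith
  obtain ⟨t, rfl⟩ := key
  exact ⟨t, fun h0 => hu (by simp [h0]), rfl⟩

namespace Vertex

theorem first_injective : Function.Injective first := by decide

theorem first_ne_apex (i : Fin 4) : first i ≠ o := by revert i; decide

variable {g : Vertex → Plane}

/-- In every realization the vertices lie on the four rays through the vertices that the apex
sees. -/
theorem exists_isRayChart (hg : Function.Injective g) (hG : familyVisibilityGraph g = graph) :
    ∃ (r : Vertex → Fin 4) (h : Vertex → ℝ),
      IsRayChart g o (fun i => g (first i) - g o) r h ∧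
      (∀ i, r (first i) = i ∧ h (first i) = 1) ∧
      (∀ v, v ≠ o → v ≠ first (r v) → h v < 1) := by
  have key : ∀ v, ∃ (i : Fin 4) (t : ℝ), v ≠ o →
      0 < t ∧ t ≤ 1 ∧ t • (g v - g o) = g (first i) - g o := by
    intro v
    by_cases hv : v = o
    · exact ⟨0, 0, fun h => absurd hv h⟩
    obtain ⟨q, hq, t, h⟩ := exists_adj_smul_eq hg hv
    rw [hG] at hq
    obtain ⟨i, rfl⟩ := exists_eq_first_of_graph_apex_adj hq
    exact ⟨i, t, fun _ => h⟩
  choose r h H using key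
  have hadj : ∀ i, (familyVisibilityGraph g).Adj o (first i) := fun i => by
    rw [hG]; exact graph_apex_adj_first i
  have hr : ∀ i, r (first i) = i := by
    intro i
    obtain ⟨h1, -, h2⟩ := H (first i) (first_ne_apex i)
    exact first_injective (eq_of_apex_adj_of_smul_eq hg (hadj _) (hadj _) h1 h2.symm)
  refine ⟨r, h, ⟨fun v hv => (H v hv).1, fun v hv => ?_⟩, fun i => ⟨hr i, ?_⟩, fun v hv hne => ?_⟩
  · obtain ⟨h1, -, h2⟩ := H v hv
    rw [← h2, smul_smul, inv_mul_cancel₀ h1.ne', one_smul]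
    simp
  · obtain ⟨h1, -, h2⟩ := H (first i) (first_ne_apex i)
    rw [hr i] at h2
    have h0 : g (first i) - g o ≠ 0 := sub_ne_zero.2 (hg.ne (first_ne_apex i))
    exact smul_left_injective ℝ h0 (h2.trans (one_smul ℝ _).symm)
  · obtain ⟨-, h1, h2⟩ := H v hv
    refine lt_of_le_of_ne h1 fun h3 => hne (hg ?_)
    rw [h3, one_smul, sub_left_inj] at h2
    exact h2

end Vertex

/-- A strictly decreasing chain of four values within a strictly decreasing chain of four values is
the whole chain. -/
theorem eq_of_chain_of_mem {x0 x1 x2 x3 y0 y1 y2 y3 : ℝ} (hy1 : y1 < y0) (hy2 : y2 < y1)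
    (hy3 : y3 < y2) (hx1 : x1 < x0) (hx2 : x2 < x1) (hx3 : x3 < x2)
    (h0 : x0 = y0 ∨ x0 = y1 ∨ x0 = y2 ∨ x0 = y3) (h1 : x1 = y0 ∨ x1 = y1 ∨ x1 = y2 ∨ x1 = y3)
    (h2 : x2 = y0 ∨ x2 = y1 ∨ x2 = y2 ∨ x2 = y3) (h3 : x3 = y0 ∨ x3 = y1 ∨ x3 = y2 ∨ x3 = y3) :
    x0 = y0 ∧ x1 = y1 ∧ x2 = y2 ∧ x3 = y3 := by
  -- Upper bounds propagate down the chain from `y0`, and lower bounds propagate up from `y3`.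
  have a0 : x0 ≤ y0 := by rcases h0 with h | h | h | h <;> linarith
  have a1 : x1 ≤ y1 := by rcases h1 with h | h | h | h <;> linarith
  have a2 : x2 ≤ y2 := by rcases h2 with h | h | h | h <;> linarith
  have a3 : x3 ≤ y3 := by rcases h3 with h | h | h | h <;> linarith
  have b3 : y3 ≤ x3 := by rcases h3 with h | h | h | h <;> linarith
  have b2 : y2 ≤ x2 := by rcases h2 with h | h | h | h <;> linarith
  have b1 : y1 ≤ x1 := by rcases h1 with h | h | h | h <;> linarith
  have b0 : y0 ≤ x0 := by rcases h0 with h | h | h | h <;> linarith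
  exact ⟨le_antisymm a0 b0, le_antisymm a1 b1, le_antisymm a2 b2, le_antisymm a3 b3⟩

/-! ### Ordered rays in an arbitrary realization -/

/-- The order of four directions, up to the orientation sign `κ`. The angle from the first to the
last may be flat. -/
structure IsOrdered (κ : ℝ) (e : Fin 4 → Plane) : Prop where
  pos01 : 0 < κ * planeCross (e 0) (e 1)
  pos02 : 0 < κ * planeCross (e 0) (e 2)
  pos12 : 0 < κ * planeCross (e 1) (e 2)
  pos13 : 0 < κ * planeCross (e 1) (e 3)
  pos23 : 0 < κ * planeCross (e 2) (e 3)

namespace IsOrdered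

variable {κ : ℝ} {e : Fin 4 → Plane}

theorem not_lt_of_pos (E : IsOrdered κ e) {i j : Fin 4} (hij : i < j) (h : (i, j) ≠ (0, 3)) :
    -- The pair (0, 3) is left out because `IsOrdered` does not determine its sign.
    ¬ 0 < κ * planeCross (e j) (e i) := by
  rw [planeCross_comm]
  have := E.pos01
  have := E.pos02
  have := E.pos12
  have := E.pos13
  have := E.pos23
  fin_cases i <;> fin_cases j <;> simp at hij h <;> simp <;> linarith

theorem not_pos_self (i : Fin 4) : ¬ 0 < κ * planeCross (e i) (e i) := by
  simp [planeCross_self]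

/-- Strictly inside the angle of the rays `0` and `2` there is only the ray `1`. -/
theorem eq_one (E : IsOrdered κ e) {j : Fin 4} (h1 : 0 < κ * planeCross (e 0) (e j))
    (h2 : 0 < κ * planeCross (e j) (e 2)) : j = 1 := by
  fin_cases j
  · exact absurd h1 (not_pos_self 0)
  · rfl
  · exact absurd h2 (not_pos_self 2)
  · exact absurd h2 (E.not_lt_of_pos (i := 2) (j := 3) (by decide) (by decide))

/-- Strictly inside the angle of the rays `1` and `3` there is only the ray `2`. -/
theorem eq_two (E : IsOrdered κ e) {j : Fin 4} (h1 : 0 < κ * planeCross (e 1) (e j))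
    (h2 : 0 < κ * planeCross (e j) (e 3)) : j = 2 := by
  fin_cases j
  · exact absurd h1 (E.not_lt_of_pos (i := 0) (j := 1) (by decide) (by decide))
  · exact absurd h1 (not_pos_self 1)
  · rfl
  · exact absurd h2 (not_pos_self 3)

/-- There is no ray strictly inside the angle of two consecutive rays. -/
theorem not_between (E : IsOrdered κ e) {i k : Fin 4} (hik : (i : ℕ) + 1 = k) (j : Fin 4)
    (h1 : 0 < κ * planeCross (e i) (e j)) (h2 : 0 < κ * planeCross (e j) (e k)) : False := by
  rcases lt_trichotomy i j with hij | rfl | hij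
  · rcases lt_trichotomy j k with hjk | rfl | hjk
    · rw [Fin.lt_def] at hij hjk
      omega
    · exact not_pos_self _ h2
    · refine E.not_lt_of_pos hjk ?_ h2
      rintro ⟨⟩
      simp at hik
  · exact not_pos_self _ h1
  · refine E.not_lt_of_pos hij ?_ h1
    rintro ⟨⟩
    have := k.2
    simp at hik
    omega

theorem pos_consecutive (E : IsOrdered κ e) {i k : Fin 4} (hik : (i : ℕ) + 1 = k) :
    0 < κ * planeCross (e i) (e k) := by
  fin_cases i <;> fin_cases k <;> simp at hik
  exacts [E.pos01, E.pos12, E.pos23]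

end IsOrdered

/-- A blocker would need a ray strictly inside the angle of two consecutive rays. The contrapositive
is what locates vertices on rays. -/
theorem IsRayChart.adj_of_consecutive {V : Type*} {g : V → Plane} {o : V} {e : Fin 4 → Plane}
    {r : V → Fin 4} {h : V → ℝ} (S : IsRayChart g o e r h) {κ : ℝ} (E : IsOrdered κ e) {u w : V}
    (hu : u ≠ o) (hw : w ≠ o) (huw : (r u : ℕ) + 1 = r w) : (familyVisibilityGraph g).Adj u w := by
  by_contra H
  obtain ⟨v, -, h1, h2, -⟩ := S.exists_blocker hu hw (E.pos_consecutive huw) H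
  exact E.not_between huw _ h1 h2

namespace Vertex

theorem graph_adj_of_visible {u w : Vertex} (h : (u, w) ∈ visiblePairs) : graph.Adj u w :=
  graph_adj_of_mem_visiblePairs (u, w) h

theorem graph_not_adj_of_blocked {u w : Vertex} (v : Vertex) (h : (u, v, w) ∈ blockedTriples) :
    ¬ graph.Adj u w :=
  graph_not_adj_of_mem_blockedTriples (u, v, w) h

variable {g : Vertex → Plane} {r : Vertex → Fin 4} {h : Vertex → ℝ}

/-- The neighbours of the apex on rays 0 and 2, 1 and 3, and 0 and 3 do not see each other. Each
such pair is therefore opposite or has another ray strictly inside its angle, and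
`isInside_of_blocked` applies. -/
theorem exists_isOrdered (hg : Function.Injective g) (hG : familyVisibilityGraph g = graph)
    (S : IsRayChart g o (fun i => g (first i) - g o) r h) (hr : ∀ i, r (first i) = i) :
    ∃ κ, IsOrdered κ (fun i => g (first i) - g o) := by
  set e : Fin 4 → Plane := fun i => g (first i) - g o with he
  have hadj : ∀ i, (familyVisibilityGraph g).Adj o (first i) := fun i => by
    rw [hG]; exact graph_apex_adj_first i
  have h0 : ∀ i, e i ≠ 0 := fun i => sub_ne_zero.2 (hg.ne (first_ne_apex i))
  have hsame : ∀ i j, i ≠ j → ∀ t : ℝ, 0 < t → e i ≠ t • e j := fun i j hij t ht H =>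
    hij (first_injective (eq_of_apex_adj_of_smul_eq hg (hadj i) (hadj j) ht H))
  -- The apex sees both endpoints, so parallel directions cannot agree and must be opposite.
  have hopp : ∀ i j, i ≠ j → planeCross (e i) (e j) = 0 → IsOpposite (e i) (e j) := by
    intro i j hij H
    obtain ⟨t, ht, H⟩ := exists_smul_eq_of_planeCross_eq_zero (h0 i) (h0 j) H
    have : t < 0 := lt_of_le_of_ne (not_lt.1 fun h' => hsame i j hij t h' H) ht
    exact ⟨-t, by linarith, by rw [neg_neg]; exact H⟩
  have hblocked : ∀ i k, i ≠ k → ¬ graph.Adj (first i) (first k) →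
      IsOpposite (e i) (e k) ∨ ∃ j, IsInside (e i) (e j) (e k) := by
    intro i k hik H
    by_cases hc : planeCross (e i) (e k) = 0
    · exact Or.inl (hopp i k hik hc)
    have hc' : 0 < planeCross (e i) (e k) * planeCross (e (r (first i))) (e (r (first k))) := by
      rw [hr, hr]; exact mul_self_pos.2 hc
    rw [← hG] at H
    obtain ⟨v, -, h1, h2, -⟩ := S.exists_blocker (first_ne_apex i) (first_ne_apex k) hc' H
    rw [hr] at h1 h2
    exact Or.inr ⟨r v, h1, h2⟩
  have left : ∀ {u w : Plane}, ¬ IsInside u u w := fun h' => by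
    have := h'.1; simp [planeCross_self] at this
  have right : ∀ {u w : Plane}, ¬ IsInside u w w := fun h' => by
    have := h'.2; simp [planeCross_self] at this
  have h02 := hblocked 0 2 (by decide) (graph_not_adj_of_blocked b0 (by decide))
  have h13 := hblocked 1 3 (by decide) (graph_not_adj_of_blocked c0 (by decide))
  have h03 := hblocked 0 3 (by decide) (graph_not_adj_of_blocked b0 (by decide))
  have exp : ∀ {p : Fin 4 → Prop}, (∃ j, p j) → p 0 ∨ p 1 ∨ p 2 ∨ p 3 := by
    rintro p ⟨j, hj⟩
    fin_cases j <;> simp_all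
  obtain ⟨q1, q2⟩ := isInside_of_blocked (hopp 0 1 (by decide)) (hopp 3 2 (by decide))
    (hsame 1 0 (by decide)) (hsame 1 2 (by decide)) (hsame 2 1 (by decide))
    (hsame 2 3 (by decide))
    (h02.imp_right fun H => by
      rcases exp H with h' | h' | h' | h'
      exacts [absurd h' left, Or.inl h', absurd h' right, Or.inr h'])
    (h13.imp_right fun H => by
      rcases exp H with h' | h' | h' | h'
      exacts [Or.inl h', absurd h' left, Or.inr h', absurd h' right])
    (h03.imp_right fun H => by
      rcases exp H with h' | h' | h' | h'
      exacts [absurd h' left, Or.inl h', Or.inr h', absurd h' right])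
  have c12 : planeCross (e 1) (e 2) ≠ 0 := fun h' => by
    have := q1.2; rw [h'] at this; simp at this
  have q1' := q1.2
  have q2' := q2.1
  rw [mul_comm] at q1' q2'
  have p12 : 0 < planeCross (e 1) (e 2) * planeCross (e 1) (e 2) := mul_self_pos.2 c12
  -- Any number with the sign of the orientation serves as `κ`; the two middle directions supply
  -- one.
  refine ⟨planeCross (e 1) (e 2), ⟨?_, q1', p12, q2', ?_⟩⟩
  · exact pos_of_mul_pos_common q1.2 q1.1
  · exact pos_of_mul_pos_common q2.1 q2.2

end Vertex

/-! ### The incidences behind the golden ratio -/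

/-- The heights along four rays satisfy a chain of incidences that forces the golden ratio. -/
theorem golden_of_incidences {p q m s t a2 b1 b2 b3 c1 c2 c3 d1 d2 x0 x1 x2 x3 y0 y1 y2 y3 z : ℝ}
    (hp : 0 < p) (hq : 0 < q) (hm : 0 < m) (hs : 0 < s) (ht : 0 < t) (ha2 : a2 < 1) (hb1 : b1 < 1)
    (hb2 : b2 < b1) (hb3 : b3 < b2) (hc1 : c1 < 1) (hc2 : c2 < c1) (hc3 : c3 < c2) (hd1 : d1 < 1)
    (hd2 : d2 < d1)
    (hx0 : q * x0 = m + p) (hx1 : q * x1 = m + p * c1) (hx2 : q * x2 = m + p * c2)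
    (hx3 : q * x3 = m * a2 + p * c3) (hy0 : s * y0 = t + m) (hy1 : s * y1 = t + m * d1)
    (hy2 : s * y2 = t * b1 + m * d1) (hy3 : s * y3 = t * b2 + m * d2) (hz : s * z = t * b2 + m)
    (mx0 : x0 = 1 ∨ x0 = b1 ∨ x0 = b2 ∨ x0 = b3) (mx1 : x1 = 1 ∨ x1 = b1 ∨ x1 = b2 ∨ x1 = b3)
    (mx2 : x2 = 1 ∨ x2 = b1 ∨ x2 = b2 ∨ x2 = b3) (mx3 : x3 = 1 ∨ x3 = b1 ∨ x3 = b2 ∨ x3 = b3)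
    (my0 : y0 = 1 ∨ y0 = c1 ∨ y0 = c2 ∨ y0 = c3) (my1 : y1 = 1 ∨ y1 = c1 ∨ y1 = c2 ∨ y1 = c3)
    (my2 : y2 = 1 ∨ y2 = c1 ∨ y2 = c2 ∨ y2 = c3) (my3 : y3 = 1 ∨ y3 = c1 ∨ y3 = c2 ∨ y3 = c3)
    (mz : z = 1 ∨ z = c1 ∨ z = c2 ∨ z = c3) :
    p * t * (p * t + q * s) = (q * s) ^ 2 := by
  have pc1 := mul_lt_mul_of_pos_left hc1 hp
  have pc2 := mul_lt_mul_of_pos_left hc2 hp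
  have pc3 := mul_lt_mul_of_pos_left hc3 hp
  have pa2 := mul_lt_mul_of_pos_left ha2 hm
  have pd1 := mul_lt_mul_of_pos_left hd1 hm
  have pd2 := mul_lt_mul_of_pos_left hd2 hm
  have pb1 := mul_lt_mul_of_pos_left hb1 ht
  have pb2 := mul_lt_mul_of_pos_left hb2 ht
  -- The blocker heights decrease strictly because the endpoint heights do, so the blockers are
  -- identified as 1, `b1`, `b2`, `b3`, and similarly on the next ray.
  obtain ⟨rfl, rfl, rfl, rfl⟩ := eq_of_chain_of_mem hb1 hb2 hb3
    (lt_of_mul_lt_mul_left (by linarith : q * x1 < q * x0) hq.le)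
    (lt_of_mul_lt_mul_left (by linarith : q * x2 < q * x1) hq.le)
    (lt_of_mul_lt_mul_left (by linarith : q * x3 < q * x2) hq.le) mx0 mx1 mx2 mx3
  obtain ⟨rfl, rfl, rfl, rfl⟩ := eq_of_chain_of_mem hc1 hc2 hc3
    (lt_of_mul_lt_mul_left (by linarith : s * y1 < s * y0) hs.le)
    (lt_of_mul_lt_mul_left (by linarith : s * y2 < s * y1) hs.le)
    (lt_of_mul_lt_mul_left (by linarith : s * y3 < s * y2) hs.le) my0 my1 my2 my3
  have z1 : z < 1 := lt_of_mul_lt_mul_left (by linarith : s * z < s * 1) hs.le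
  have z3 : y3 < z := lt_of_mul_lt_mul_left (by linarith : s * y3 < s * z) hs.le
  -- Put ρ = pt / (qs), and note that `y1`, `y2` are now `c1`, `c2`. Projecting from ray to ray
  -- gives c1 - c2 = ρ(1 - c1).
  have step : q * s * (y1 - y2) = p * t * (1 - y1) := by
    linear_combination q * hy1 - q * hy2 + t * hx0 - t * hx1
  rcases mz with rfl | rfl | rfl | rfl
  · exact absurd z1 (lt_irrefl _)
  -- Here `z` is `c1`, so 1 - c1 = ρ(1 - c2) = ρ(1 + ρ)(1 - c1), and 1 - c1 cancels.
  · have step' : q * s * (1 - z) = p * t * (1 - y2) := by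
      linear_combination q * hy0 - q * hz + t * hx0 - t * hx2
    have hk : 1 - z ≠ 0 := by linarith
    apply mul_right_cancel₀ hk
    linear_combination -(q * s) * step' - p * t * step
  -- Here `z` is `c2`, which would force ρ = 1, whereas p < q and t < s.
  · have step' : q * s * (1 - z) = p * t * (1 - z) := by
      linear_combination q * hy0 - q * hz + t * hx0 - t * hx2
    have hk : 1 - z ≠ 0 := by linarith
    have := mul_right_cancel₀ hk step'
    have h1 : p < q := by linarith
    have h2 : t < s := by linarith
    have := mul_lt_mul h1 h2.le ht hq.le
    linarith
  · exact absurd z3 (lt_irrefl _)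

/-! ### Rays and heights of the vertices in every realization -/

namespace Vertex

/-- A realization of `graph` by the points `g v`, with ray coordinates in which the vertices that
the apex sees have height `1`. -/
structure IsNormalized (g : Vertex → Plane) (κ : ℝ) (e : Fin 4 → Plane) (r : Vertex → Fin 4)
    (h : Vertex → ℝ) : Prop where
  injective : Function.Injective g
  graph_eq : familyVisibilityGraph g = graph
  chart : IsRayChart g o e r h
  ordered : IsOrdered κ e
  ray_first : ∀ i, r (first i) = i
  height_first : ∀ i, h (first i) = 1
  height_lt : ∀ v, v ≠ o → v ≠ first (r v) → h v < 1

namespace IsNormalized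

variable {g : Vertex → Plane} {κ : ℝ} {e : Fin 4 → Plane} {r : Vertex → Fin 4} {h : Vertex → ℝ}

theorem height_ne (N : IsNormalized g κ e r h) {u v : Vertex} (hu : u ≠ o) (hv : v ≠ o)
    (huv : u ≠ v) (hr : r u = r v) : h u ≠ h v := by
  intro hh
  apply huv
  apply N.injective
  rw [N.chart.eq u hu, N.chart.eq v hv, hr, hh]

/-- Otherwise `v` would lie between `p` and `u` on their ray and block them. -/
theorem lt_of_adj (N : IsNormalized g κ e r h) {p u v : Vertex} (hadj : graph.Adj p u)
    (hp : p ≠ o) (hu : u ≠ o) (hv : v ≠ o) (huv : u ≠ v) (hpu : r p = r u) (hvu : r v = r u)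
    (hlt : h v < h p) : h v < h u := by
  rcases lt_trichotomy (h v) (h u) with h1 | h1 | h1
  · exact h1
  · exact absurd h1 (N.height_ne hv hu huv.symm hvu)
  · rw [← N.graph_eq] at hadj
    exact absurd hadj (N.chart.not_adj_of_same_ray hp hv hu (hpu.trans hvu.symm) hvu hlt h1)

/-- A point has at most one visible point below it on its own ray. -/
theorem not_adj_of_adj (N : IsNormalized g κ e r h) {p u v : Vertex} (hpu : graph.Adj p u)
    (hp : p ≠ o) (hu : u ≠ o) (hv : v ≠ o) (huv : u ≠ v) (hru : r p = r u) (hrv : r p = r v)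
    (hup : h u < h p) (hvp : h v < h p) : ¬ graph.Adj p v := fun hpv =>
  lt_asymm (N.lt_of_adj hpu hp hu hv huv hru (hrv.symm.trans hru) hvp)
    (N.lt_of_adj hpv hp hv hu huv.symm hrv (hru.symm.trans hrv) hup)

theorem not_consecutive (N : IsNormalized g κ e r h) {u w : Vertex} (hu : u ≠ o) (hw : w ≠ o)
    (H : ¬ graph.Adj u w) : (r u : ℕ) + 1 ≠ r w ∧ (r w : ℕ) + 1 ≠ r u := by
  rw [← N.graph_eq] at H
  exact ⟨fun h' => H (N.chart.adj_of_consecutive N.ordered hu hw h'),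
    fun h' => H (N.chart.adj_of_consecutive N.ordered hw hu h').symm⟩

theorem height_lt_first (N : IsNormalized g κ e r h) {i : Fin 4} {v : Vertex} (hv : v ≠ o)
    (hr : r v = i) (hne : v ≠ first i) : h v < h (first i) := by
  rw [N.height_first]
  subst hr
  exact N.height_lt v hv hne

/-- Of two points on a ray, the vertex seen by the apex sees at most one. -/
theorem not_adj_first (N : IsNormalized g κ e r h) (i : Fin 4) {u v : Vertex}
    (hiu : graph.Adj (first i) u) (hu : u ≠ o) (hv : v ≠ o) (huv : u ≠ v) (hru : r u = i)
    (hrv : r v = i) (hui : u ≠ first i) (hvi : v ≠ first i) : ¬ graph.Adj (first i) v :=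
  N.not_adj_of_adj hiu (first_ne_apex i) hu hv huv ((N.ray_first i).trans hru.symm)
    ((N.ray_first i).trans hrv.symm) (N.height_lt_first hu hru hui) (N.height_lt_first hv hrv hvi)

/-- The second vertex on a ray sees at most one vertex farther out. -/
theorem not_adj_second (N : IsNormalized g κ e r h) (i : Fin 4) {p u v : Vertex}
    (hip : graph.Adj (first i) p) (hpu : graph.Adj p u) (hp : p ≠ o) (hu : u ≠ o) (hv : v ≠ o)
    (hpv' : p ≠ v) (huv : u ≠ v) (hrp : r p = i) (hru : r u = i) (hrv : r v = i)
    (hui : u ≠ first i) (hvi : v ≠ first i) : ¬ graph.Adj p v := by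
  have key : ∀ w, w ≠ o → p ≠ w → r w = i → w ≠ first i → h w < h p := fun w hw hpw hrw hwi =>
    N.lt_of_adj hip (first_ne_apex i) hp hw hpw ((N.ray_first i).trans hrp.symm)
      (hrw.trans hrp.symm) (N.height_lt_first hw hrw hwi)
  exact N.not_adj_of_adj hpu hp hu hv huv (hrp.trans hru.symm) (hrp.trans hrv.symm)
    (key u hu hpu.ne hru hui) (key v hv hpv' hrv hvi)

/-- In every realization the vertices lie on the same rays as in `point`. -/
theorem ray_eq (N : IsNormalized g κ e r h) : ∀ v, v ≠ o → r v = ray v := by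
  have ra0 : r a0 = 0 := N.ray_first 0
  have rb0 : r b0 = 1 := N.ray_first 1
  have rc0 : r c0 = 2 := N.ray_first 2
  have rd0 : r d0 = 3 := N.ray_first 3
  have bl : ∀ {u w : Vertex} (v : Vertex), (u, v, w) ∈ blockedTriples → u ≠ o → w ≠ o →
      (r u : ℕ) + 1 ≠ r w ∧ (r w : ℕ) + 1 ≠ r u := fun v H hu hw =>
    N.not_consecutive hu hw (graph_not_adj_of_blocked v H)
  -- Not being consecutive to ray 2 excludes rays 1 and 3, and not being consecutive to ray 3
  -- excludes ray 2. The same works for `a2` and, mirrored, for `d1` and `d2`.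
  have ra1 : r a1 = 0 := by
    have q1 := bl (u := a1) (w := c0) b1 (by decide) (by decide) (by decide)
    have q2 := bl (u := a1) (w := d0) c2 (by decide) (by decide) (by decide)
    rw [rc0] at q1; rw [rd0] at q2
    generalize r a1 = i at *
    revert q1 q2; revert i; decide
  have ra2 : r a2 = 0 := by
    have q1 := bl (u := a2) (w := c0) b2 (by decide) (by decide) (by decide)
    have q2 := bl (u := a2) (w := d0) b3 (by decide) (by decide) (by decide)
    rw [rc0] at q1; rw [rd0] at q2
    generalize r a2 = i at *
    revert q1 q2; revert i; decide
  have rd1 : r d1 = 3 := by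
    have q1 := bl (u := a0) (w := d1) c3 (by decide) (by decide) (by decide)
    have q2 := bl (u := b0) (w := d1) c1 (by decide) (by decide) (by decide)
    rw [ra0] at q1; rw [rb0] at q2
    generalize r d1 = i at *
    revert q1 q2; revert i; decide
  have rd2 : r d2 = 3 := by
    have q1 := bl (u := a0) (w := d2) b3 (by decide) (by decide) (by decide)
    have q2 := bl (u := b0) (w := d2) c2 (by decide) (by decide) (by decide)
    rw [ra0] at q1; rw [rb0] at q2
    generalize r d2 = i at *
    revert q1 q2; revert i; decide
  have vis : ∀ {u w : Vertex}, (u, w) ∈ visiblePairs → graph.Adj u w := graph_adj_of_visible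
  -- Ray 0 is excluded for whatever else `a0` sees, since `a1` is the one point it sees there; `n0'`
  -- uses `a1` and `a2` in the same way, and `n3`, `n3'` treat ray 3.
  have n0 : ∀ v, v ≠ o → (a0, v) ∈ visiblePairs → v ≠ a1 → v ≠ a0 → r v ≠ 0 :=
    fun v hv hp h1 h0 hr => N.not_adj_first 0 (vis (w := a1) (by decide)) (by decide) hv h1.symm
      ra1 hr (by decide) h0 (vis hp)
  have n3 : ∀ v, v ≠ o → graph.Adj v d0 → v ≠ d1 → v ≠ d0 → r v ≠ 3 :=
    fun v hv hp h1 h0 hr => N.not_adj_first 3 (vis (w := d1) (by decide)) (by decide) hv h1.symm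
      rd1 hr (by decide) h0 hp.symm
  have n0' : ∀ v, v ≠ o → graph.Adj a1 v → v ≠ a2 → v ≠ a1 → v ≠ a0 → r v ≠ 0 :=
    fun v hv hp h2 h1 h0 hr => N.not_adj_second 0 (vis (w := a1) (by decide))
      (vis (w := a2) (by decide)) (by decide) (by decide) hv h1.symm h2.symm ra1 ra2 hr
      (by decide) h0 hp
  have n3' : ∀ v, v ≠ o → graph.Adj v d1 → v ≠ d2 → v ≠ d1 → v ≠ d0 → r v ≠ 3 :=
    fun v hv hp h2 h1 h0 hr => N.not_adj_second 3 (vis (w := d1) (by decide))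
      (vis (w := d2) (by decide)) (by decide) (by decide) hv h1.symm h2.symm rd1 rd2 hr
      (by decide) h0 hp.symm
  have rb : ∀ v, v ≠ o → r v ≠ 0 → r v ≠ 3 → (∃ w, r w = 3 ∧ w ≠ o ∧ ¬ graph.Adj v w) →
      r v = 1 := by
    rintro v hv q0 q3 ⟨w, hw, hwo, H⟩
    have q := (N.not_consecutive hv hwo H).1
    rw [hw] at q
    generalize r v = i at *
    revert q0 q3 q; revert i; decide
  have rc : ∀ v, v ≠ o → r v ≠ 0 → r v ≠ 3 → (∃ w, r w = 0 ∧ w ≠ o ∧ ¬ graph.Adj w v) →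
      r v = 2 := by
    rintro v hv q0 q3 ⟨w, hw, hwo, H⟩
    have q := (N.not_consecutive hwo hv H).1
    rw [hw] at q
    generalize r v = i at *
    revert q0 q3 q; revert i; decide
  have rb1 : r b1 = 1 := rb b1 (by decide)
    (n0 b1 (by decide) (by decide) (by decide) (by decide))
    (n3 b1 (by decide) (vis (by decide)) (by decide) (by decide))
    ⟨d1, rd1, by decide, graph_not_adj_of_blocked c2 (by decide)⟩
  have rb2 : r b2 = 1 := rb b2 (by decide)
    (n0 b2 (by decide) (by decide) (by decide) (by decide))
    (n3' b2 (by decide) (vis (by decide)) (by decide) (by decide) (by decide))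
    ⟨d0, rd0, by decide, graph_not_adj_of_blocked c1 (by decide)⟩
  have rb3 : r b3 = 1 := rb b3 (by decide)
    (n0 b3 (by decide) (by decide) (by decide) (by decide))
    (n3' b3 (by decide) (vis (by decide)) (by decide) (by decide) (by decide))
    ⟨d0, rd0, by decide, graph_not_adj_of_blocked c3 (by decide)⟩
  have rc1 : r c1 = 2 := rc c1 (by decide)
    (n0' c1 (by decide) (vis (by decide)) (by decide) (by decide) (by decide))
    (n3 c1 (by decide) (vis (by decide)) (by decide) (by decide))
    ⟨a0, ra0, by decide, graph_not_adj_of_blocked b1 (by decide)⟩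
  have rc2 : r c2 = 2 := rc c2 (by decide)
    (n0' c2 (by decide) (vis (by decide)) (by decide) (by decide) (by decide))
    (n3 c2 (by decide) (vis (by decide)) (by decide) (by decide))
    ⟨a0, ra0, by decide, graph_not_adj_of_blocked b2 (by decide)⟩
  have rc3 : r c3 = 2 := rc c3 (by decide)
    (n0 c3 (by decide) (by decide) (by decide) (by decide))
    (n3 c3 (by decide) (vis (by decide)) (by decide) (by decide))
    ⟨a2, ra2, by decide, graph_not_adj_of_blocked b3 (by decide)⟩
  intro v hv
  cases v
  case o => exact absurd rfl hv
  all_goals assumption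

/-- Along each ray, a vertex seen from the preceding one is above all later ones. -/
theorem height_lt_second (N : IsNormalized g κ e r h) (i : Fin 4) {u v : Vertex}
    (hiu : (first i, u) ∈ visiblePairs) (hu : u ≠ o) (hv : v ≠ o) (huv : u ≠ v) (hru : ray u = i)
    (hrv : ray v = i) (hvi : v ≠ first i) : h v < h u :=
  N.lt_of_adj (graph_adj_of_visible hiu) (first_ne_apex i) hu hv huv
    ((N.ray_first i).trans ((N.ray_eq u hu).trans hru).symm)
    ((N.ray_eq v hv).trans (hrv.trans ((N.ray_eq u hu).trans hru).symm))
    (N.height_lt_first hv ((N.ray_eq v hv).trans hrv) hvi)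

/-- The blockers between the rays `0` and `2`. -/
theorem exists_blocker_ray_one (N : IsNormalized g κ e r h) {u w : Vertex} (hu : u ≠ o)
    (hw : w ≠ o) (hru : ray u = 0) (hrw : ray w = 2) (H : ¬ graph.Adj u w) :
    ∃ v, (v = b0 ∨ v = b1 ∨ v = b2 ∨ v = b3) ∧
      planeCross (e 0) (e 2) * h v = planeCross (e 1) (e 2) * h u + planeCross (e 0) (e 1) * h w := by
  rw [← N.graph_eq] at H
  have e1 : r u = 0 := (N.ray_eq u hu).trans hru
  have e2 : r w = 2 := (N.ray_eq w hw).trans hrw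
  obtain ⟨v, hv, h1, h2, h3⟩ := N.chart.exists_blocker hu hw
    (by rw [e1, e2]; exact N.ordered.pos02) H
  rw [e1] at h1 h3
  rw [e2] at h2 h3
  have hrv := N.ordered.eq_one h1 h2
  rw [hrv] at h3
  refine ⟨v, ?_, h3⟩
  rw [N.ray_eq v hv] at hrv
  revert hrv
  clear * -
  cases v <;> decide

/-- The blockers between the rays `1` and `3`. -/
theorem exists_blocker_ray_two (N : IsNormalized g κ e r h) {u w : Vertex} (hu : u ≠ o)
    (hw : w ≠ o) (hru : ray u = 1) (hrw : ray w = 3) (H : ¬ graph.Adj u w) :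
    ∃ v, (v = c0 ∨ v = c1 ∨ v = c2 ∨ v = c3) ∧
      planeCross (e 1) (e 3) * h v = planeCross (e 2) (e 3) * h u + planeCross (e 1) (e 2) * h w := by
  rw [← N.graph_eq] at H
  have e1 : r u = 1 := (N.ray_eq u hu).trans hru
  have e2 : r w = 3 := (N.ray_eq w hw).trans hrw
  obtain ⟨v, hv, h1, h2, h3⟩ := N.chart.exists_blocker hu hw
    (by rw [e1, e2]; exact N.ordered.pos13) H
  rw [e1] at h1 h3
  rw [e2] at h2 h3
  have hrv := N.ordered.eq_two h1 h2
  rw [hrv] at h3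
  refine ⟨v, ?_, h3⟩
  rw [N.ray_eq v hv] at hrv
  revert hrv
  clear * -
  cases v <;> decide

/-- The ratio of the two products below is the inverse of the golden ratio. -/
theorem planeCross_relation (N : IsNormalized g κ e r h) :
    (planeCross (e 0) (e 2) * planeCross (e 1) (e 3)) ≠ 0 ∧
    (planeCross (e 0) (e 1) * planeCross (e 2) (e 3)) *
      (planeCross (e 0) (e 1) * planeCross (e 2) (e 3) +
        planeCross (e 0) (e 2) * planeCross (e 1) (e 3)) =
      (planeCross (e 0) (e 2) * planeCross (e 1) (e 3)) ^ 2 := by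
  have w01 := N.ordered.pos01
  have w02 := N.ordered.pos02
  have w12 := N.ordered.pos12
  have w13 := N.ordered.pos13
  have w23 := N.ordered.pos23
  have ha0 : h a0 = 1 := N.height_first 0
  have hb0 : h b0 = 1 := N.height_first 1
  have hc0 : h c0 = 1 := N.height_first 2
  have hd0 : h d0 = 1 := N.height_first 3
  have below : ∀ v i, v ≠ o → ray v = i → v ≠ first i → h v < 1 := fun v i hv hr hne => by
    rw [← N.height_first i]
    exact N.height_lt_first hv ((N.ray_eq v hv).trans hr) hne
  have a2lt : h a2 < 1 := below a2 0 (by decide) (by decide) (by decide)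
  have b1lt : h b1 < 1 := below b1 1 (by decide) (by decide) (by decide)
  have c1lt : h c1 < 1 := below c1 2 (by decide) (by decide) (by decide)
  have d1lt : h d1 < 1 := below d1 3 (by decide) (by decide) (by decide)
  have second : ∀ (i : Fin 4) (u v : Vertex), (first i, u) ∈ visiblePairs → u ≠ o → v ≠ o →
      u ≠ v → ray u = i → ray v = i → v ≠ first i → h v < h u := fun i u v =>
    N.height_lt_second i
  have b2lt : h b2 < h b1 := second 1 b1 b2 (by decide) (by decide) (by decide) (by decide)
    (by decide) (by decide) (by decide)
  have b3lt' : h b3 < h b1 := second 1 b1 b3 (by decide) (by decide) (by decide) (by decide)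
    (by decide) (by decide) (by decide)
  have c2lt : h c2 < h c1 := second 2 c1 c2 (by decide) (by decide) (by decide) (by decide)
    (by decide) (by decide) (by decide)
  have c3lt' : h c3 < h c1 := second 2 c1 c3 (by decide) (by decide) (by decide) (by decide)
    (by decide) (by decide) (by decide)
  have d2lt : h d2 < h d1 := second 3 d1 d2 (by decide) (by decide) (by decide) (by decide)
    (by decide) (by decide) (by decide)
  have same : ∀ u v : Vertex, u ≠ o → v ≠ o → ray u = ray v → r u = r v := fun u v hu hv hr => by
    rw [N.ray_eq u hu, N.ray_eq v hv, hr]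
  have b3lt : h b3 < h b2 := N.lt_of_adj (p := b1) (graph_adj_of_visible (by decide)) (by decide)
    (by decide) (by decide) (by decide) (same _ _ (by decide) (by decide) rfl)
    (same _ _ (by decide) (by decide) rfl) b3lt'
  have c3lt : h c3 < h c2 := N.lt_of_adj (p := c1) (graph_adj_of_visible (by decide)) (by decide)
    (by decide) (by decide) (by decide) (same _ _ (by decide) (by decide) rfl)
    (same _ _ (by decide) (by decide) rfl) c3lt'
  -- The listed middle vertex only certifies non-adjacency; in this realization the blocker may a
  -- priori be any vertex of the middle ray.
  have block1 : ∀ u v w : Vertex, (u, v, w) ∈ blockedTriples → u ≠ o → w ≠ o → ray u = 0 →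
      ray w = 2 → ∃ v, (v = b0 ∨ v = b1 ∨ v = b2 ∨ v = b3) ∧ planeCross (e 0) (e 2) * h v =
        planeCross (e 1) (e 2) * h u + planeCross (e 0) (e 1) * h w :=
    fun u v w H hu hw hru hrw => N.exists_blocker_ray_one hu hw hru hrw
      (graph_not_adj_of_blocked v H)
  have block2 : ∀ u v w : Vertex, (u, v, w) ∈ blockedTriples → u ≠ o → w ≠ o → ray u = 1 →
      ray w = 3 → ∃ v, (v = c0 ∨ v = c1 ∨ v = c2 ∨ v = c3) ∧ planeCross (e 1) (e 3) * h v =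
        planeCross (e 2) (e 3) * h u + planeCross (e 1) (e 2) * h w :=
    fun u v w H hu hw hru hrw => N.exists_blocker_ray_two hu hw hru hrw
      (graph_not_adj_of_blocked v H)
  obtain ⟨x0, mx0, hx0⟩ := block1 a0 b0 c0 (by decide) (by decide) (by decide) rfl rfl
  obtain ⟨x1, mx1, hx1⟩ := block1 a0 b1 c1 (by decide) (by decide) (by decide) rfl rfl
  obtain ⟨x2, mx2, hx2⟩ := block1 a0 b2 c2 (by decide) (by decide) (by decide) rfl rfl
  obtain ⟨x3, mx3, hx3⟩ := block1 a2 b3 c3 (by decide) (by decide) (by decide) rfl rfl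
  obtain ⟨y0, my0, hy0⟩ := block2 b0 c0 d0 (by decide) (by decide) (by decide) rfl rfl
  obtain ⟨y1, my1, hy1⟩ := block2 b0 c1 d1 (by decide) (by decide) (by decide) rfl rfl
  obtain ⟨y2, my2, hy2⟩ := block2 b1 c2 d1 (by decide) (by decide) (by decide) rfl rfl
  obtain ⟨y3, my3, hy3⟩ := block2 b2 c3 d2 (by decide) (by decide) (by decide) rfl rfl
  obtain ⟨z, mz, hz⟩ := block2 b2 c1 d0 (by decide) (by decide) (by decide) rfl rfl
  have img : ∀ {v p0 p1 p2 p3 : Vertex}, (v = p0 ∨ v = p1 ∨ v = p2 ∨ v = p3) →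
      h v = h p0 ∨ h v = h p1 ∨ h v = h p2 ∨ h v = h p3 := by
    rintro v p0 p1 p2 p3 (rfl | rfl | rfl | rfl) <;> simp
  replace mx0 := img mx0
  replace mx1 := img mx1
  replace mx2 := img mx2
  replace mx3 := img mx3
  replace my0 := img my0
  replace my1 := img my1
  replace my2 := img my2
  replace my3 := img my3
  replace mz := img mz
  rw [hb0] at mx0 mx1 mx2 mx3
  rw [hc0] at my0 my1 my2 my3 mz
  rw [ha0, hc0] at hx0
  rw [ha0] at hx1 hx2
  rw [hb0, hd0] at hy0
  rw [hb0] at hy1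
  rw [hd0] at hz
  have hκ : κ ≠ 0 := fun h0 => by simp [h0] at w01
  have key := golden_of_incidences w01 w02 w12 w13 w23 a2lt b1lt b2lt b3lt c1lt c2lt c3lt d1lt d2lt
    (by linear_combination κ * hx0) (by linear_combination κ * hx1)
    (by linear_combination κ * hx2) (by linear_combination κ * hx3)
    (by linear_combination κ * hy0) (by linear_combination κ * hy1)
    (by linear_combination κ * hy2) (by linear_combination κ * hy3)
    (by linear_combination κ * hz) mx0 mx1 mx2 mx3 my0 my1 my2 my3 mz
  refine ⟨mul_ne_zero (fun h0 => ?_) (fun h0 => ?_), ?_⟩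
  · simp [h0] at w02
  · simp [h0] at w13
  -- The relation was obtained for cross products multiplied by `κ`, and it is homogeneous of degree
  -- 4 in them.
  · apply mul_left_cancel₀ (pow_ne_zero 4 hκ)
    linear_combination key

end IsNormalized

end Vertex

/-! ### Irrationality and conclusion -/

theorem exists_rat_planeCross {u v w : Plane} (hu : ∀ i, ∃ q : ℚ, (q : ℝ) = u i)
    (hv : ∀ i, ∃ q : ℚ, (q : ℝ) = v i) (hw : ∀ i, ∃ q : ℚ, (q : ℝ) = w i) :
    ∃ q : ℚ, (q : ℝ) = planeCross (v - u) (w - u) := by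
  choose x hx using hu
  choose y hy using hv
  choose z hz using hw
  refine ⟨(y 0 - x 0) * (z 1 - x 1) - (y 1 - x 1) * (z 0 - x 0), ?_⟩
  simp [planeCross, hx, hy, hz]

/-- Completing the square would make (2P + Q) / Q a rational square root of 5. -/
theorem rat_not_golden {P Q : ℚ} (hQ : Q ≠ 0) : P * (P + Q) ≠ Q ^ 2 := by
  intro H
  have h5 : ((2 * P + Q) / Q) ^ 2 = 5 := by
    field_simp
    linear_combination 4 * H
  refine (Nat.prime_five.irrational_sqrt) ⟨|(2 * P + Q) / Q|, ?_⟩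
  have : ((((2 * P + Q) / Q : ℚ)) : ℝ) ^ 2 = 5 := by exact_mod_cast h5
  rw [Rat.cast_abs, ← Real.sqrt_sq_eq_abs, this]
  norm_num

theorem Vertex.exists_irrational {g : Vertex → Plane} (hg : Function.Injective g)
    (hG : familyVisibilityGraph g = Vertex.graph) : ∃ v i, Irrational (g v i) := by
  by_contra! H
  have hrat : ∀ v i, ∃ q : ℚ, (q : ℝ) = g v i := fun v i => by
    simpa [Irrational] using H v i
  obtain ⟨r, h, S, hf, hlt⟩ := Vertex.exists_isRayChart hg hG
  obtain ⟨κ, E⟩ := Vertex.exists_isOrdered hg hG S fun i => (hf i).1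
  have N : Vertex.IsNormalized g κ (fun i => g (Vertex.first i) - g Vertex.o) r h :=
    ⟨hg, hG, S, E, fun i => (hf i).1, fun i => (hf i).2, hlt⟩
  obtain ⟨hQ, key⟩ := N.planeCross_relation
  have hc : ∀ i j, ∃ q : ℚ, (q : ℝ) =
      planeCross (g (Vertex.first i) - g Vertex.o) (g (Vertex.first j) - g Vertex.o) :=
    fun i j => exists_rat_planeCross (hrat _) (hrat _) (hrat _)
  choose c hc using hc
  simp only [← hc] at hQ key
  exact rat_not_golden (P := c 0 1 * c 2 3) (Q := c 0 2 * c 1 3) (by exact_mod_cast hQ)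
    (by exact_mod_cast key)

theorem mainTheorem2 :
    ∃ (V : Type) (_ : Finite V) (G : SimpleGraph V),
      IsPointVisibilityGraph G ∧
        ∀ P : Set Plane, IsRealization G P → ∃ x ∈ P, ∃ i : Fin 2, Irrational (x i) := by
  refine ⟨Vertex, inferInstance, Vertex.graph,
    ⟨Set.range Vertex.point, isRealization_range Vertex.point_injective⟩, fun P hP => ?_⟩
  obtain ⟨g, hg, hgP, hG⟩ := hP.exists_family
  obtain ⟨v, i, hi⟩ := Vertex.exists_irrational hg hG
  exact ⟨g v, hgP v, i, hi⟩
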